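/- For a permutation $w = w_1 w_2 \cdots w_n$ in the symmetric group $S_n$, let $\mathrm{is}(w)$ denote the maximal length of an increasing subsequence of $w$. For $0 \le s \le n$ let $$\Pi_{n,s} = \{\, w \in S_n \mid w_1 < w_2 < \cdots < w_{n-s},\ \mathrm{is}(w) = n-s \,\}.$$ Then for all integers $n, k \ge 0$ with $n \ge 2k$, $$\sum_{s=0}^{k} \binom{k}{s}\, \#\Pi_{n,s} = \binom{n}{k}\, k!.$$ -/

import Mathlib

/-- `longestIncr w` is the maximal length of an increasing subsequence of `w(0), …, w(n-1)`.
An increasing subsequence is given by its set `T` of positions, on which `w` is strictly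
increasing, and its length is the number of these positions. -/
def longestIncr {n : ℕ} (w : Equiv.Perm (Fin n)) : ℕ :=
  ((Finset.univ : Finset (Finset (Fin n))).filter
    (fun T => ∀ i ∈ T, ∀ j ∈ T, i < j → w i < w j)).sup Finset.card

/-- `PiSet n k` is the set of the permutations `w` of `n` letters whose first `n - k` entries are
increasing and whose longest increasing subsequence has length exactly `n - k`.
Positions are numbered from `0`, so `i + k < n` says that `i` is among the first `n - k`
positions; writing `n - k` additively avoids truncated subtraction. -/
def PiSet (n k : ℕ) : Finset (Equiv.Perm (Fin n)) :=
  Finset.univ.filter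
    (fun w => (∀ i j : Fin n, i < j → (j : ℕ) + k < n → w i < w j) ∧ longestIncr w + k = n)

/-! The right side counts the injective words `f` of length `k` in `n` letters. Insert the letters
of such an `f`, in order, into the row of the other `n - k` letters, and record at each step whether
a letter is bumped. This splits the words into `2 ^ k` fibres, one for each pattern `β`; those with
`s` bumps number `k.choose s`. It remains to see that each of these has `(PiSet n s).card` elements.

Insertion can be undone: `β`, the final row `R'` and the bumped letters `c` determine the word
(`BumpRun.left_unique`). So a fibre is counted by the pairs `(R', c)` that can be reversed along
`β`. Undoing a growth removes only the maximum of the row, and undoing a bump of `y` is possible as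
soon as the row has a letter below `y`. As `n - s ≥ k`, the smallest letters of the row survive long
enough for growths never to matter (`BumpRun.exists_iff`), so the fibre is as large as that of `s`
bumps in a row (`card_hasBumps`).

Finally, a permutation with increasing head is determined by its last `s` entries, and by a form of
Schensted's theorem its longest increasing subsequence stays at `n - s` exactly when all `s`
insertions bump (`longestIncr_eq_iff`, `BumpRun.eq_replicate_iff`). -/

/-! ### Row insertion and its determinism in both directions -/

/-- `BumpRun β R l R' c`: inserting the letters of `l` one by one into the row `R`, by the rule of
the Schensted algorithm, gives the row `R'`, and `c` lists the letters bumped out. The list `β`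
records for each insertion whether it bumped a letter (`true`) or lengthened the row (`false`). -/
inductive BumpRun {α : Type*} [LinearOrder α] :
    List Bool → Finset α → List α → Finset α → List α → Prop
  | nil (R : Finset α) : BumpRun [] R [] R []
  | grow {β : List Bool} {R : Finset α} {x : α} {l : List α} {R' : Finset α} {c : List α} :
      (∀ r ∈ R, r < x) → BumpRun β (insert x R) l R' c →
      BumpRun (false :: β) R (x :: l) R' c
  | bump {β : List Bool} {R : Finset α} {x y : α} {l : List α} {R' : Finset α} {c : List α} :
      x ∉ R → y ∈ R → x < y → (∀ r ∈ R, x < r → y ≤ r) →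
      BumpRun β (insert x (R.erase y)) l R' c →
      BumpRun (true :: β) R (x :: l) R' (y :: c)

namespace BumpRun

variable {α : Type*} [LinearOrder α]

theorem length_eq {β : List Bool} {R R' : Finset α} {l c : List α} (h : BumpRun β R l R' c) :
    l.length = β.length := by
  induction h <;> simp_all

theorem count_eq {β : List Bool} {R R' : Finset α} {l c : List α} (h : BumpRun β R l R' c) :
    c.length = β.count true := by
  induction h <;> simp_all

theorem add_eq {β : List Bool} {R R' : Finset α} {l c : List α} (h : BumpRun β R l R' c) :
    R.val + (l : Multiset α) = R'.val + (c : Multiset α) := by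
  induction h with
  | nil => rfl
  | @grow β R x l R' c hx _ ih =>
    have hxR : x ∉ R := fun h => lt_irrefl _ (hx x h)
    rw [Finset.insert_val_of_notMem hxR] at ih
    rw [← ih, ← Multiset.cons_coe, Multiset.add_cons, Multiset.cons_add]
  | @bump β R x y l R' c hxR hy hxy _ _ ih =>
    have hx : x ∉ R.erase y := fun h => hxR (Finset.mem_of_mem_erase h)
    rw [Finset.insert_val_of_notMem hx] at ih
    rw [← Multiset.cons_coe, ← Multiset.cons_coe, Multiset.add_cons, Multiset.add_cons, ← ih,
      Multiset.cons_add, Multiset.cons_swap, ← Multiset.cons_add y, Finset.erase_val,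
      Multiset.cons_erase hy]

theorem right_unique {β β₁ : List Bool} {R R' R'₁ : Finset α} {l c c₁ : List α}
    (h : BumpRun β R l R' c) (h₁ : BumpRun β₁ R l R'₁ c₁) : β = β₁ ∧ R' = R'₁ ∧ c = c₁ := by
  induction h generalizing β₁ c₁ with
  | nil => cases h₁; simp
  | grow hx _ ih =>
    cases h₁ with
    | grow _ h₂ => obtain ⟨rfl, rfl, rfl⟩ := ih h₂; simp
    | bump _ hy hxy => exact absurd (hx _ hy) (not_lt.2 hxy.le)
  | bump hxR hy hxy hmin _ ih =>
    cases h₁ with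
    | grow hx => exact absurd (hx _ hy) (not_lt.2 hxy.le)
    | bump _ hy' hxy' hmin' h₂ =>
      obtain rfl := le_antisymm (hmin _ hy' hxy') (hmin' _ hy hxy)
      obtain ⟨rfl, rfl, rfl⟩ := ih h₂; simp

/-- A growth is undone by removing the maximum of the row, a bump of `y` by putting `y` in place of
the largest letter below it; neither leaves a choice. -/
theorem left_unique {β : List Bool} {R R₁ R' : Finset α} {l l₁ c : List α}
    (h : BumpRun β R l R' c) (h₁ : BumpRun β R₁ l₁ R' c) : R = R₁ ∧ l = l₁ := by
  induction h generalizing R₁ l₁ with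
  | nil => cases h₁; simp
  | @grow β R x l R' c hx _ ih =>
    cases h₁ with
    | @grow _ _ x₁ _ _ _ hx₁ h₂ =>
      obtain ⟨hR, rfl⟩ := ih h₂
      have hxx : x = x₁ := by
        have a : x ∈ insert x₁ R₁ := hR ▸ Finset.mem_insert_self _ _
        have b : x₁ ∈ insert x R := hR ▸ Finset.mem_insert_self _ _
        rcases Finset.mem_insert.1 a with a | a
        · exact a
        rcases Finset.mem_insert.1 b with b | b
        · exact b.symm
        exact absurd (hx _ b) (hx₁ _ a).asymm
      subst hxx
      have n₁ : x ∉ R := fun h => lt_irrefl _ (hx x h)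
      have n₂ : x ∉ R₁ := fun h => lt_irrefl _ (hx₁ x h)
      refine ⟨?_, rfl⟩
      rw [← Finset.erase_insert n₁, hR, Finset.erase_insert n₂]
  | @bump β R x y l R' c hxR hy hxy hmin _ ih =>
    cases h₁ with
    | @bump _ _ x₁ _ _ _ _ hxR₁ hy₁ hxy₁ hmin₁ h₂ =>
      obtain ⟨hR, rfl⟩ := ih h₂
      have hxx : x = x₁ := by
        have a : x ∈ insert x₁ (R₁.erase y) := hR ▸ Finset.mem_insert_self _ _
        have b : x₁ ∈ insert x (R.erase y) := hR ▸ Finset.mem_insert_self _ _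
        rcases Finset.mem_insert.1 a with a | a
        · exact a
        rcases Finset.mem_insert.1 b with b | b
        · exact b.symm
        rcases lt_trichotomy x x₁ with h | h | h
        · exact absurd (hmin _ (Finset.mem_of_mem_erase b) h) (not_le.2 hxy₁)
        · exact h
        · exact absurd (hmin₁ _ (Finset.mem_of_mem_erase a) h) (not_le.2 hxy)
      subst hxx
      have n₁ : x ∉ R.erase y := fun h => hxR (Finset.mem_of_mem_erase h)
      have n₂ : x ∉ R₁.erase y := fun h => hxR₁ (Finset.mem_of_mem_erase h)
      have e : R.erase y = R₁.erase y := by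
        rw [← Finset.erase_insert n₁, hR, Finset.erase_insert n₂]
      refine ⟨?_, rfl⟩
      rw [← Finset.insert_erase hy, e, Finset.insert_erase hy₁]

theorem exists_of_nodup (l : List α) (R : Finset α)
    (h : (R.val + (l : Multiset α)).Nodup) : ∃ β R' c, BumpRun β R l R' c := by
  induction l generalizing R with
  | nil => exact ⟨_, _, _, nil R⟩
  | cons x l ih =>
    rw [← Multiset.cons_coe, Multiset.add_cons, Multiset.nodup_cons] at h
    obtain ⟨hx, hn⟩ := h
    have hxR : x ∉ R := fun h => hx (Multiset.mem_add.2 (Or.inl h))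
    by_cases hR : ∃ y ∈ R, x < y
    · have hne : (R.filter (x < ·)).Nonempty := by
        obtain ⟨y, hy⟩ := hR
        exact ⟨y, Finset.mem_filter.2 hy⟩
      obtain ⟨y, hy⟩ : ∃ y, y = (R.filter (x < ·)).min' hne := ⟨_, rfl⟩
      have hyR := Finset.mem_filter.1 (Finset.min'_mem _ hne)
      rw [← hy] at hyR
      have n₁ : x ∉ R.erase y := fun h => hxR (Finset.mem_of_mem_erase h)
      obtain ⟨β, R', c, hrun⟩ := ih (insert x (R.erase y)) (by
        rw [Finset.insert_val_of_notMem n₁, Multiset.cons_add, Multiset.nodup_cons]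
        refine ⟨fun h => hx ?_, ?_⟩
        · exact Multiset.mem_of_le
            (Multiset.add_le_add_right (Multiset.erase_le y R.val)) h
        · exact Multiset.nodup_of_le
            (Multiset.add_le_add_right (Multiset.erase_le y R.val)) hn)
      refine ⟨_, _, _, bump hxR hyR.1 hyR.2 (fun r hr hxr => ?_) hrun⟩
      rw [hy]
      exact Finset.min'_le _ _ (Finset.mem_filter.2 ⟨hr, hxr⟩)
    · push Not at hR
      obtain ⟨β, R', c, hrun⟩ := ih (insert x R) (by
        rw [Finset.insert_val_of_notMem hxR, Multiset.cons_add, Multiset.nodup_cons]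
        exact ⟨hx, hn⟩)
      exact ⟨_, _, _, grow (fun r hr => lt_of_le_of_ne (hR r hr) fun e => hxR (e ▸ hr)) hrun⟩

/-! ### Reverse insertion along different patterns -/

/-- A run can be extended backwards by a bump of `y` if its row has a letter below `y`. -/
theorem exists_bump {β : List Bool} {R R' : Finset α} {l c : List α} {y : α}
    (h : BumpRun β R l R' c) (hyR : y ∉ R) (hy : ∃ r ∈ R, r < y) :
    ∃ S m, BumpRun (true :: β) S m R' (y :: c) := by
  have hne : (R.filter (· < y)).Nonempty := by
    obtain ⟨r, hr⟩ := hy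
    exact ⟨r, Finset.mem_filter.2 hr⟩
  obtain ⟨x, hx⟩ : ∃ x, x = (R.filter (· < y)).max' hne := ⟨_, rfl⟩
  have hxR := Finset.mem_filter.1 (Finset.max'_mem _ hne)
  rw [← hx] at hxR
  have n₁ : y ∉ R.erase x := fun h => hyR (Finset.mem_of_mem_erase h)
  refine ⟨insert y (R.erase x), x :: l, bump ?_ (Finset.mem_insert_self _ _) hxR.2 ?_ ?_⟩
  · simp [hxR.2.ne]
  · intro r hr hxr
    rcases Finset.mem_insert.1 hr with rfl | hr
    · exact le_rfl
    · by_contra hlt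
      have := Finset.le_max' (R.filter (· < y)) r
        (Finset.mem_filter.2 ⟨Finset.mem_of_mem_erase hr, not_le.1 hlt⟩)
      rw [← hx] at this
      exact absurd hxr (not_lt.2 this)
  · rwa [Finset.erase_insert n₁, Finset.insert_erase hxR.1]

theorem exists_grow {β : List Bool} {R R' : Finset α} {l c : List α}
    (h : BumpRun β R l R' c) (hR : R.Nonempty) :
    ∃ S m, BumpRun (false :: β) S m R' c := by
  refine ⟨R.erase (R.max' hR), R.max' hR :: l, grow ?_ ?_⟩
  · intro r hr
    exact Finset.lt_max'_of_mem_erase_max' _ _ hr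
  · rwa [Finset.insert_erase (Finset.max'_mem _ _)]

open Classical in
/-- Two runs with the same result, one of which only bumps, start from rows which agree on their
smallest letters. -/
theorem exists_agree {β : List Bool} {R R' Q : Finset α} {l m c : List α}
    (h : BumpRun β R l R' c) (hQ : BumpRun (List.replicate c.length true) Q m R' c)
    (hlen : β.length ≤ R'.card) :
    ∃ U : Set α, IsLowerSet U ∧ (∀ a ∈ U, a ∈ R ↔ a ∈ Q) ∧
      R'.card ≤ β.length + (R.filter (· ∈ U)).card := by
  induction h generalizing Q m with
  | nil R =>
    cases hQ
    exact ⟨Set.univ, isLowerSet_univ, by simp, by simp⟩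
  | @grow β R x l R' c hx _ ih =>
    simp only [List.length_cons] at hlen
    obtain ⟨U, hU, hag, hcard⟩ := ih hQ (by lia)
    have hne : ((insert x R).filter (· ∈ U)).Nonempty := Finset.card_pos.1 (by lia)
    obtain ⟨M, hM⟩ : ∃ M, M = ((insert x R).filter (· ∈ U)).max' hne := ⟨_, rfl⟩
    have hMm := Finset.mem_filter.1 (Finset.max'_mem _ hne)
    have hMle := fun r hr => Finset.le_max' ((insert x R).filter (· ∈ U)) r hr
    rw [← hM] at hMm
    simp only [← hM] at hMle
    have hMx : M ≤ x := by
      rcases Finset.mem_insert.1 hMm.1 with h | h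
      exacts [h.le, (hx _ h).le]
    -- Undoing a step costs at most one common letter, the largest one `M`: here the removed maximum
    -- `x` is at least `M`, so nothing below `M` changes.
    obtain ⟨V, hV⟩ : ∃ V, V = Set.Iio M := ⟨_, rfl⟩
    refine ⟨V, hV ▸ isLowerSet_Iio M, fun a ha => ?_, ?_⟩
    · rw [hV] at ha
      rw [← hag a (hU (le_of_lt ha) hMm.2), Finset.mem_insert]
      have : a ≠ x := (lt_of_lt_of_le ha hMx).ne
      simp [this]
    · have hsub : (insert x R).filter (· ∈ U) ⊆ insert M (R.filter (· ∈ V)) := by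
        intro a ha
        rcases (hMle a ha).eq_or_lt with h | h
        · simp [h]
        · have : a ≠ x := (lt_of_lt_of_le h hMx).ne
          have haR := (Finset.mem_filter.1 ha).1
          simp only [Finset.mem_insert, this, false_or] at haR
          simp [haR, h, hV]
      have := (Finset.card_le_card hsub).trans (Finset.card_insert_le _ _)
      simp only [List.length_cons]
      lia
  | @bump β R x y l R' c hxR hy hxy hmin _ ih =>
    simp only [List.length_cons] at hlen
    simp only [List.length_cons, List.replicate_succ] at hQ
    cases hQ with
    | @bump _ _ z _ _ _ _ hzQ hyQ hzy hminQ hQ =>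
    obtain ⟨U, hU, hag, hcard⟩ := ih hQ (by lia)
    have hne : ((insert x (R.erase y)).filter (· ∈ U)).Nonempty := Finset.card_pos.1 (by lia)
    obtain ⟨M, hM⟩ : ∃ M, M = ((insert x (R.erase y)).filter (· ∈ U)).max' hne := ⟨_, rfl⟩
    have hMm := Finset.mem_filter.1 (Finset.max'_mem _ hne)
    have hMle := fun r hr => Finset.le_max' ((insert x (R.erase y)).filter (· ∈ U)) r hr
    rw [← hM] at hMm
    simp only [← hM] at hMle
    have hMQ := (hag M hMm.2).1 hMm.1
    have hMy : M ≠ y := by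
      rintro rfl
      simp [hxy.ne'] at hMm
    have hlt : ∀ a < M, a ∈ insert x (R.erase y) ↔ a ∈ insert z (Q.erase y) :=
      fun a ha => hag a (hU ha.le hMm.2)
    obtain ⟨V, hV⟩ : ∃ V, V = Set.Iio M := ⟨_, rfl⟩
    simp only [Finset.mem_insert, Finset.mem_erase] at hlt hMm hMQ
    rcases lt_or_gt_of_ne hMy with hMy | hMy
    -- For `M < y`, both rows give up a letter that is at least `M`, so they are untouched below
    -- `M`.
    · have hMx : M ≤ x := by
        rcases hMm.1 with h | h
        · exact h.le
        · exact not_lt.1 fun h' => absurd (hmin _ h.2 h') (not_le.2 hMy)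
      have hMz : M ≤ z := by
        rcases hMQ with h | h
        · exact h.le
        · exact not_lt.1 fun h' => absurd (hminQ _ h.2 h') (not_le.2 hMy)
      refine ⟨V, hV ▸ isLowerSet_Iio M, fun a ha => ?_, ?_⟩
      · rw [hV] at ha
        have := hlt a ha
        simpa [(ha.trans_le hMx).ne, (ha.trans_le hMz).ne, (ha.trans hMy).ne] using this
      · have hsub : (insert x (R.erase y)).filter (· ∈ U) ⊆ insert M (R.filter (· ∈ V)) := by
          intro a ha
          rcases (hMle a ha).eq_or_lt with h | h
          · simp [h]
          · have haR := (Finset.mem_filter.1 ha).1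
            simp only [Finset.mem_insert, (h.trans_le hMx).ne, false_or] at haR
            simp [Finset.mem_of_mem_erase haR, h, hV]
        have := (Finset.card_le_card hsub).trans (Finset.card_insert_le _ _)
        simp only [List.length_cons]
        lia
    -- For `y < M`, the rows agree up to `M`, so the largest letter below `y` is the same in both,
    -- and they change alike.
    · have hxz : x = z := by
        have h₁ := (hlt x (hxy.trans hMy)).1 (Or.inl rfl)
        have h₂ := (hlt z (hzy.trans hMy)).2 (Or.inl rfl)
        rcases h₁ with h₁ | h₁
        · exact h₁
        rcases h₂ with h₂ | h₂
        · exact h₂.symm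
        rcases lt_trichotomy x z with h | h | h
        · exact absurd (hmin _ h₂.2 h) (not_le.2 hzy)
        · exact h
        · exact absurd (hminQ _ h₁.2 h) (not_le.2 hxy)
      subst hxz
      refine ⟨V, hV ▸ isLowerSet_Iio M, fun a ha => ?_, ?_⟩
      · rw [hV] at ha
        have := hlt a ha
        by_cases hay : a = y
        · simp [hay, hy, hyQ]
        by_cases hax : a = x
        · simp [hax, hxR, hzQ]
        simpa [hay, hax] using this
      · have hyV : y ∈ R.filter (· ∈ V) := by simp [hy, hV, hMy]
        have hsub : (insert x (R.erase y)).filter (· ∈ U) ⊆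
            insert M (insert x ((R.filter (· ∈ V)).erase y)) := by
          intro a ha
          rcases (hMle a ha).eq_or_lt with h | h
          · simp [h]
          · have haR := (Finset.mem_filter.1 ha).1
            simp only [Finset.mem_insert, Finset.mem_erase] at haR
            rcases haR with rfl | haR
            · simp
            · simp [haR, h, hV]
        have h₁ := Finset.card_le_card hsub
        have h₂ := Finset.card_insert_le M (insert x ((R.filter (· ∈ V)).erase y))
        have h₃ := Finset.card_insert_le x ((R.filter (· ∈ V)).erase y)
        have h₄ := Finset.card_erase_add_one hyV
        simp only [List.length_cons]
        lia

theorem mem_of_run {β : List Bool} {R R' : Finset α} {l c : List α} (h : BumpRun β R l R' c)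
    {a : α} (ha : a ∈ R) : a ∈ R' ∨ a ∈ c := by
  have : a ∈ R.val + (l : Multiset α) := Multiset.mem_add.2 (Or.inl ha)
  rw [h.add_eq] at this
  simpa using this

/-- Growths can be dropped or inserted freely: by `exists_agree` the two rows share a small letter
at every stage before the last reverse step, so each reverse bump is possible in both or in neither,
and the row for `β` is never empty when a maximum has to be removed. -/
theorem exists_iff {β : List Bool} {R' : Finset α} {c : List α}
    (hc : c.length = β.count true) (hlen : β.length ≤ R'.card)
    (hn : (R'.val + (c : Multiset α)).Nodup) :
    (∃ R l, BumpRun β R l R' c) ↔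
      ∃ R l, BumpRun (List.replicate c.length true) R l R' c := by
  classical
  induction β generalizing c with
  | nil =>
    obtain rfl : c = [] := by simpa using hc
    rfl
  | cons b β ih =>
    simp only [List.length_cons] at hlen
    cases b with
    | false =>
      have ih := ih (c := c) (by simpa using hc) (by lia) hn
      constructor
      · rintro ⟨R, l, h⟩
        cases h with
        | grow _ h => exact ih.1 ⟨_, _, h⟩
      · rintro ⟨Q, m, hQ⟩
        obtain ⟨R, l, h⟩ := ih.2 ⟨_, _, hQ⟩
        obtain ⟨U, -, -, hU⟩ := h.exists_agree hQ (by lia)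
        refine h.exists_grow ?_
        exact (Finset.card_pos.1 (by lia : 0 < (R.filter (· ∈ U)).card)).mono
          (Finset.filter_subset _ _)
    | true =>
      cases c with
      | nil => simp at hc
      | cons y c =>
        rw [← Multiset.cons_coe, Multiset.add_cons, Multiset.nodup_cons] at hn
        obtain ⟨hy, hn⟩ := hn
        have ih := ih (c := c) (by simpa using hc) (by lia) hn
        have key : ∀ {R l Q m}, BumpRun β R l R' c →
            BumpRun (List.replicate c.length true) Q m R' c →
            y ∉ R ∧ y ∉ Q ∧ ((∃ r ∈ R, r < y) ↔ ∃ r ∈ Q, r < y) := by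
          intro R l Q m h hQ
          refine ⟨fun hyR => hy ?_, fun hyQ => hy ?_, ?_⟩
          · simpa using h.mem_of_run hyR
          · simpa using hQ.mem_of_run hyQ
          -- The common letter `a` transfers the witness: a letter `r ≤ a` lies in both rows, and if
          -- `a ≤ r < y` then `a` itself is below `y`.
          · obtain ⟨U, hU, hag, hcard⟩ := h.exists_agree hQ (by lia)
            obtain ⟨a, ha⟩ := Finset.card_pos.1 (by lia : 0 < (R.filter (· ∈ U)).card)
            obtain ⟨haR, haU⟩ := Finset.mem_filter.1 ha
            constructor
            · rintro ⟨r, hr, hry⟩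
              rcases le_total r a with h | h
              · exact ⟨r, (hag r (hU h haU)).1 hr, hry⟩
              · exact ⟨a, (hag a haU).1 haR, h.trans_lt hry⟩
            · rintro ⟨r, hr, hry⟩
              rcases le_total r a with h | h
              · exact ⟨r, (hag r (hU h haU)).2 hr, hry⟩
              · exact ⟨a, haR, h.trans_lt hry⟩
        simp only [List.length_cons, List.replicate_succ]
        constructor
        · rintro ⟨S, l, h⟩
          cases h with
          | @bump _ _ x _ _ _ _ _ _ hxy _ h =>
            obtain ⟨Q, m, hQ⟩ := ih.1 ⟨_, _, h⟩
            obtain ⟨-, hyQ, hiff⟩ := key h hQ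
            exact hQ.exists_bump hyQ (hiff.1 ⟨x, Finset.mem_insert_self _ _, hxy⟩)
        · rintro ⟨S, l, h⟩
          cases h with
          | @bump _ _ x _ _ _ _ _ _ hxy _ hQ =>
            obtain ⟨R, l, h⟩ := ih.2 ⟨_, _, hQ⟩
            obtain ⟨hyR, -, hiff⟩ := key h hQ
            exact h.exists_bump hyR (hiff.2 ⟨x, Finset.mem_insert_self _ _, hxy⟩)

end BumpRun

/-! ### Bumps and increasing subsequences -/

/-- An increasing subsequence of `l` with first letter `b`, preceded by the letters of `R` below
`b`, is longer than `R`. -/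
def HasLongIncr {α : Type*} [LinearOrder α] (R : Finset α) (l : List α) : Prop :=
  ∃ b B, (b :: B).Sublist l ∧ (b :: B).Pairwise (· < ·) ∧ (R.filter (b < ·)).card ≤ B.length

/-- The invariant behind Schensted's theorem: a bump neither creates nor destroys a long sequence. A
sequence starting with `x` loses its head, which is paid for by the departure of `y`; conversely a
head strictly between `x` and `y` gets `x` prepended. -/
theorem hasLongIncr_cons_iff {α : Type*} [LinearOrder α] {R : Finset α} {x y : α} {l : List α}
    (hxR : x ∉ R) (hy : y ∈ R) (hxy : x < y) (hmin : ∀ r ∈ R, x < r → y ≤ r) (hxl : x ∉ l) :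
    HasLongIncr R (x :: l) ↔ HasLongIncr (insert x (R.erase y)) l := by
  constructor
  · rintro ⟨b, B, hsub, hB, hcard⟩
    rcases List.sublist_cons_iff.1 hsub with hsub | ⟨B', hBB', hsub⟩
    · refine ⟨b, B, hsub, hB, le_trans ?_ hcard⟩
      rcases lt_or_ge b y with hby | hby
      · have hyb : y ∈ R.filter (b < ·) := by simp [hy, hby]
        have h₁ : (insert x (R.erase y)).filter (b < ·) ⊆
            insert x ((R.filter (b < ·)).erase y) := by
          intro a ha
          simp only [Finset.mem_insert, Finset.mem_filter, Finset.mem_erase] at ha ⊢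
          tauto
        have h₂ := Finset.card_le_card h₁
        have h₃ := Finset.card_insert_le x ((R.filter (b < ·)).erase y)
        have h₄ := Finset.card_erase_add_one hyb
        lia
      · refine Finset.card_le_card fun a ha => ?_
        simp only [Finset.mem_insert, Finset.mem_filter, Finset.mem_erase] at ha ⊢
        rcases ha with ⟨rfl | ha, hba⟩
        · exact absurd (hxy.trans_le hby) hba.asymm
        · exact ⟨ha.2, hba⟩
    · obtain ⟨rfl, rfl⟩ := List.cons.inj hBB'
      have hyb : y ∈ R.filter (b < ·) := by simp [hy, hxy]
      cases B with
      -- The row letter `y` above `x` forces a second letter in the sequence.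
      | nil => simp [Finset.card_eq_zero.1 (Nat.le_zero.1 hcard)] at hyb
      | cons d B =>
        obtain ⟨hbd, hB⟩ := List.pairwise_cons.1 hB
        refine ⟨d, B, hsub, hB, ?_⟩
        have hbd := hbd d (by simp)
        have h₁ : (insert b (R.erase y)).filter (d < ·) ⊆ (R.filter (b < ·)).erase y := by
          intro a ha
          simp only [Finset.mem_insert, Finset.mem_filter, Finset.mem_erase] at ha ⊢
          rcases ha with ⟨rfl | ha, hda⟩
          · exact absurd hda hbd.asymm
          · exact ⟨ha.1, ha.2, hbd.trans hda⟩
        have h₂ := Finset.card_le_card h₁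
        have h₄ := Finset.card_erase_add_one hyb
        simp only [List.length_cons] at hcard
        lia
  · rintro ⟨b, B, hsub, hB, hcard⟩
    have hbx : b ≠ x := by
      rintro rfl
      exact hxl (hsub.subset (by simp))
    rcases lt_or_gt_of_ne hbx with hbx | hbx
    · refine ⟨b, B, hsub.cons _, hB, le_trans ?_ hcard⟩
      have hx : x ∈ (insert x (R.erase y)).filter (b < ·) := by simp [hbx]
      have h₁ : R.filter (b < ·) ⊆
          insert y (((insert x (R.erase y)).filter (b < ·)).erase x) := by
        intro a ha
        simp only [Finset.mem_insert, Finset.mem_filter, Finset.mem_erase] at ha ⊢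
        have : a ≠ x := fun h => hxR (h ▸ ha.1)
        tauto
      have h₂ := Finset.card_le_card h₁
      have h₃ := Finset.card_insert_le y (((insert x (R.erase y)).filter (b < ·)).erase x)
      have h₄ := Finset.card_erase_add_one hx
      lia
    · rcases lt_or_ge b y with hby | hby
      · refine ⟨x, b :: B, hsub.cons_cons _, List.pairwise_cons.2 ⟨fun a ha => ?_, hB⟩, ?_⟩
        · rcases List.mem_cons.1 ha with rfl | ha
          · exact hbx
          · exact hbx.trans ((List.pairwise_cons.1 hB).1 a ha)
        · have h₁ : R.filter (x < ·) ⊆ insert y ((insert x (R.erase y)).filter (b < ·)) := by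
            intro a ha
            simp only [Finset.mem_insert, Finset.mem_filter, Finset.mem_erase] at ha ⊢
            have := hby.trans_le (hmin a ha.1 ha.2)
            tauto
          have h₂ := Finset.card_le_card h₁
          have h₃ := Finset.card_insert_le y ((insert x (R.erase y)).filter (b < ·))
          simp only [List.length_cons]
          lia
      · refine ⟨b, B, hsub.cons _, hB, le_trans (Finset.card_le_card fun a ha => ?_) hcard⟩
        simp only [Finset.mem_insert, Finset.mem_filter, Finset.mem_erase] at ha ⊢
        exact ⟨Or.inr ⟨(hby.trans_lt ha.2).ne', ha.1⟩, ha.2⟩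

/-- Bumps preserve `HasLongIncr`, the first growth exhibits it with the single letter `x`, and an
empty word never has it. -/
theorem BumpRun.eq_replicate_iff {α : Type*} [LinearOrder α] {β : List Bool} {R R' : Finset α}
    {l c : List α} (h : BumpRun β R l R' c) (hn : (R'.val + (c : Multiset α)).Nodup) :
    β = List.replicate l.length true ↔ ¬ HasLongIncr R l := by
  induction h with
  | nil R => simp [HasLongIncr]
  | @grow β R x l R' c hx _ _ =>
    refine iff_of_false (by simp [List.replicate_succ]) (not_not.2 ⟨x, [], by simp, by simp, ?_⟩)
    simpa [Finset.filter_eq_empty_iff] using fun r hr => (hx r hr).le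
  | @bump β R x y l R' c hxR hy hxy hmin h ih =>
    rw [← Multiset.cons_coe, Multiset.add_cons, Multiset.nodup_cons] at hn
    have hxl : x ∉ l := by
      have := h.add_eq ▸ hn.2
      exact fun hx => (Multiset.disjoint_left.1 (Multiset.nodup_add.1 this).2.2
        (Finset.mem_insert_self x (R.erase y))) (by simpa using hx)
    rw [hasLongIncr_cons_iff hxR hy hxy hmin hxl, ← ih hn.2]
    simp [List.replicate_succ]

/-- The head alone has length `m`. A longer increasing subsequence must enter the tail; if `b` is
its first tail letter, its head part can be enlarged to all head letters below `b`. -/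
theorem longestIncr_eq_iff {m s : ℕ} (w : Equiv.Perm (Fin (m + s)))
    (hw : ∀ i j : Fin (m + s), i < j → (j : ℕ) < m → w i < w j) :
    longestIncr w = m ↔ ¬ HasLongIncr
      (Finset.univ \ (List.ofFn fun i : Fin s => w (Fin.natAdd m i)).toFinset)
      (List.ofFn fun i : Fin s => w (Fin.natAdd m i)) := by
  classical
  obtain ⟨l, hl⟩ : ∃ l, l = List.ofFn fun i : Fin s => w (Fin.natAdd m i) := ⟨_, rfl⟩
  rw [← hl]
  have hmem : ∀ a, a ∈ l ↔ m ≤ (w.symm a : ℕ) := by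
    intro a
    rw [hl, List.mem_ofFn]
    constructor
    · rintro ⟨i, rfl⟩
      simp
    · intro h
      refine ⟨⟨w.symm a - m, by lia⟩, ?_⟩
      rw [← w.eq_symm_apply]
      ext
      simp
      lia
  have hpw : l.Pairwise (fun a b => w.symm a < w.symm b) := by
    rw [hl, List.pairwise_ofFn]
    intro i j hij
    simpa using hij
  have hnd : l.Nodup := hpw.imp fun h e => by simp [e] at h
  have hlen : l.length = s := by simp [hl]
  obtain ⟨R, hR⟩ : ∃ R, R = Finset.univ \ l.toFinset := ⟨_, rfl⟩
  rw [← hR]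
  have hRmem : ∀ a, a ∈ R ↔ (w.symm a : ℕ) < m := by
    intro a
    simp [hR, hmem]
  have hRcard : R.card = m := by
    rw [hR, Finset.card_sdiff_of_subset (Finset.subset_univ _), List.toFinset_card_of_nodup hnd,
      hlen]
    simp
  have hsplit : ∀ b ∉ R, (R.filter (· < b)).card + (R.filter (b < ·)).card = m := by
    intro b hb
    refine Eq.trans ?_ hRcard
    rw [← Finset.card_filter_add_card_filter_not (s := R) (· < b)]
    congr 2
    refine Finset.filter_congr fun a ha => ?_
    rw [not_lt]
    exact ⟨le_of_lt, fun h => lt_of_le_of_ne h fun e => hb (e ▸ ha)⟩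
  have hge : m ≤ longestIncr w := by
    have : R.map w.symm.toEmbedding ∈ (Finset.univ : Finset (Finset (Fin (m + s)))).filter
        (fun T => ∀ i ∈ T, ∀ j ∈ T, i < j → w i < w j) := by
      simp only [Finset.mem_filter, Finset.mem_univ, true_and, Finset.mem_map_equiv]
      intro i _ j hj hij
      refine hw i j hij ?_
      simpa [hRmem] using hj
    have := Finset.le_sup (f := Finset.card) this
    rw [Finset.card_map, hRcard] at this
    exact this
  rw [← not_iff_not, not_not]
  have : ¬ longestIncr w = m ↔ m < longestIncr w := by lia
  rw [this, longestIncr, Finset.lt_sup_iff]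
  constructor
  · rintro ⟨T, hT, hmT⟩
    simp only [Finset.mem_filter, Finset.mem_univ, true_and] at hT
    obtain ⟨B, hB⟩ : ∃ B, B = l.filter (fun a => w.symm a ∈ T) := ⟨_, rfl⟩
    have hBT : ∀ a ∈ B, w.symm a ∈ T := by
      intro a ha
      rw [hB] at ha
      simpa using (List.mem_filter.1 ha).2
    have hBpw : B.Pairwise (· < ·) := by
      have h₁ : B.Pairwise (fun a b => w.symm a < w.symm b) := by
        rw [hB]; exact hpw.filter _
      refine h₁.imp_of_mem fun ha hb hab => ?_
      simpa using hT _ (hBT _ ha) _ (hBT _ hb) hab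
    have hBcard : B.length = (T.filter (fun i : Fin (m + s) => ¬ (i : ℕ) < m)).card := by
      rw [← List.toFinset_card_of_nodup (hB ▸ hnd.filter _),
        ← Finset.card_map (s := T.filter _) w.toEmbedding]
      congr 1
      ext a
      simp [hB, hmem, Finset.mem_map_equiv, and_comm]
    have hadd := Finset.card_filter_add_card_filter_not (s := T) (fun i : Fin (m + s) => (i : ℕ) < m)
    have hhead : ((T.filter (fun i : Fin (m + s) => (i : ℕ) < m)).map w.toEmbedding) ⊆ R := by
      intro a
      simp only [Finset.mem_map_equiv, Finset.mem_filter, hRmem]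
      exact And.right
    cases hBeq : B with
    | nil =>
      have := Finset.card_le_card hhead
      rw [Finset.card_map, hRcard] at this
      simp only [hBeq, List.length_nil] at hBcard
      lia
    | cons b B' =>
      have hbB : b ∈ B := by simp [hBeq]
      have hbl : b ∈ l := by
        rw [hB] at hbB
        exact (List.mem_filter.1 hbB).1
      have hbm := (hmem b).1 hbl
      refine ⟨b, B', ?_, hBeq ▸ hBpw, ?_⟩
      · rw [← hBeq, hB]
        exact List.filter_sublist
      · have hhead' : ((T.filter (fun i : Fin (m + s) => (i : ℕ) < m)).map w.toEmbedding) ⊆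
            R.filter (· < b) := by
          intro a ha
          refine Finset.mem_filter.2 ⟨hhead ha, ?_⟩
          simp only [Finset.mem_map_equiv, Finset.mem_filter] at ha
          have := hT _ ha.1 _ (hBT b hbB) (Fin.lt_def.2 (ha.2.trans_le hbm))
          simpa using this
        have h₁ := Finset.card_le_card hhead'
        rw [Finset.card_map] at h₁
        have h₂ := hsplit b (by rw [hRmem]; lia)
        simp only [hBeq, List.length_cons] at hBcard
        lia
  · rintro ⟨b, B, hsub, hB, hcard⟩
    have hbm := (hmem b).1 (hsub.subset (by simp))
    have hle : ∀ a ∈ b :: B, b ≤ a := by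
      intro a ha
      rcases List.mem_cons.1 ha with rfl | ha
      · exact le_rfl
      · exact ((List.pairwise_cons.1 hB).1 a ha).le
    have hord : ∀ p ∈ b :: B, ∀ q ∈ b :: B, w.symm p < w.symm q → p < q := by
      have hBl := hpw.sublist hsub
      have h₁ : (b :: B).Pairwise fun p q => (w.symm p < w.symm q → p < q) ∧
          (w.symm q < w.symm p → q < p) :=
        hB.imp₂ (fun p q h h' => ⟨fun _ => h, fun h'' => absurd h' h''.asymm⟩) hBl
      intro p hp q hq
      have hsymm : Std.Symm fun p q => (w.symm p < w.symm q → p < q) ∧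
          (w.symm q < w.symm p → q < p) := ⟨fun _ _ h => h.symm⟩
      exact (h₁.forall_of_forall
        (fun p _ => ⟨fun h => absurd h (lt_irrefl _), fun h => absurd h (lt_irrefl _)⟩) hp hq).1
    refine ⟨(R.filter (· < b) ∪ (b :: B).toFinset).map w.symm.toEmbedding, ?_, ?_⟩
    · simp only [Finset.mem_filter, Finset.mem_univ, true_and, Finset.mem_map_equiv,
        Equiv.symm_symm, Finset.mem_union, List.mem_toFinset]
      intro i hi j hj hij
      have hi' : ∀ k, w k ∈ b :: B → m ≤ (k : ℕ) := fun k hk => by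
        simpa using (hmem _).1 (hsub.subset hk)
      rcases hj with hj | hj
      · exact hw i j hij (by simpa using (hRmem _).1 hj.1)
      · rcases hi with hi | hi
        · exact hi.2.trans_le (hle _ hj)
        · exact hord _ hi _ hj (by simpa using hij)
    · rw [Finset.card_map, Finset.card_union_of_disjoint,
        List.toFinset_card_of_nodup (hnd.sublist hsub), List.length_cons]
      · have h₂ := hsplit b (by rw [hRmem]; lia)
        lia
      · rw [Finset.disjoint_left]
        intro a ha ha'
        exact absurd (Finset.mem_filter.1 ha).2 (not_lt.2 (hle a (by simpa using ha')))

/-! ### Words sorted by their pattern of steps -/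

/-- Schensted insertion of the letters of `f` into the row of all other letters has the types `β`
of steps. -/
def HasBumps {α : Type*} [LinearOrder α] [Fintype α] {k : ℕ} (β : List Bool) (f : Fin k ↪ α) :
    Prop :=
  ∃ R c, BumpRun β (Finset.univ \ (List.ofFn f).toFinset) (List.ofFn f) R c

theorem val_sdiff_add_ofFn {α : Type*} [LinearOrder α] [Fintype α] {k : ℕ} (f : Fin k ↪ α) :
    (Finset.univ \ (List.ofFn f).toFinset).val + (List.ofFn f : Multiset α) =
      (Finset.univ : Finset α).val := by
  have h : ((List.ofFn f).toFinset).val = (List.ofFn f : Multiset α) := by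
    rw [List.toFinset_val, List.dedup_eq_self.2 (List.nodup_ofFn.2 f.injective)]
  rw [Finset.sdiff_val, h]
  exact Multiset.sub_add_cancel (h ▸ Finset.val_le_iff.2 (Finset.subset_univ _))

theorem exists_ofFn_of_add_eq {α : Type*} [LinearOrder α] [Fintype α] {k : ℕ} {R : Finset α}
    {l : List α} (h : R.val + (l : Multiset α) = (Finset.univ : Finset α).val)
    (hl : l.length = k) :
    ∃ f : Fin k ↪ α, List.ofFn f = l ∧ Finset.univ \ (List.ofFn f).toFinset = R := by
  subst hl
  have hn : (R.val + (l : Multiset α)).Nodup := h ▸ Finset.univ.nodup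
  obtain ⟨-, hnl, hd⟩ := Multiset.nodup_add.1 hn
  refine ⟨⟨l.get, List.nodup_iff_injective_get.1 hnl⟩, List.ofFn_get l, ?_⟩
  simp only [Function.Embedding.coeFn_mk, List.ofFn_get]
  ext a
  have ha : a ∈ R.val + (l : Multiset α) := h ▸ Finset.mem_univ a
  have hda : a ∈ R → a ∉ l := fun h₁ h₂ =>
    Multiset.disjoint_left.1 hd (Finset.mem_val ▸ h₁) (Multiset.mem_coe.2 h₂)
  simp only [Multiset.mem_add, Finset.mem_val, Multiset.mem_coe] at ha
  simp only [Finset.mem_sdiff, Finset.mem_univ, true_and, List.mem_toFinset]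
  tauto

theorem HasBumps.existsUnique {α : Type*} [LinearOrder α] [Fintype α] {k : ℕ} (f : Fin k ↪ α) :
    ∃! β, HasBumps β f := by
  obtain ⟨β, R, c, h⟩ := BumpRun.exists_of_nodup (List.ofFn f)
    (Finset.univ \ (List.ofFn f).toFinset) (val_sdiff_add_ofFn f ▸ Finset.univ.nodup)
  exact ⟨β, ⟨R, c, h⟩, fun β' ⟨_, _, h'⟩ => (h'.right_unique h).1⟩

-- Words of the two patterns are matched when they give the same final row and the same bumped
-- letters.
open Classical in
theorem card_hasBumps {α : Type*} [LinearOrder α] [Fintype α] {k s : ℕ} {β : List Bool}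
    (hk : β.length = k) (hs : β.count true = s) (h : k + s ≤ Fintype.card α) :
    (Finset.univ.filter fun f : Fin k ↪ α => HasBumps β f).card =
      (Finset.univ.filter fun g : Fin s ↪ α => HasBumps (List.replicate s true) g).card := by
  -- The final row has `Fintype.card α - s ≥ k` letters, enough for `BumpRun.exists_iff`.
  have hlen : ∀ {R : Finset α} {c : List α}, c.length = s →
      R.val + (c : Multiset α) = (Finset.univ : Finset α).val → β.length ≤ R.card := by
    intro R c hc he
    have := congrArg Multiset.card he
    simp at this
    lia
  let r (f : Fin k ↪ α) (g : Fin s ↪ α) : Prop := ∃ R c,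
    BumpRun β (Finset.univ \ (List.ofFn f).toFinset) (List.ofFn f) R c ∧
    BumpRun (List.replicate s true) (Finset.univ \ (List.ofFn g).toFinset) (List.ofFn g) R c
  apply le_antisymm
  · refine Finset.card_le_card_of_forall_subsingleton r ?_ ?_
    · intro f hf
      obtain ⟨R, c, hf⟩ := (Finset.mem_filter.1 hf).2
      have he := hf.add_eq.symm.trans (val_sdiff_add_ofFn f)
      have hc : c.length = s := hf.count_eq.trans hs
      obtain ⟨Q, l, hQ⟩ := (BumpRun.exists_iff hf.count_eq (hlen hc he)
        (he ▸ Finset.univ.nodup)).1 ⟨_, _, hf⟩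
      rw [hc] at hQ
      obtain ⟨g, rfl, rfl⟩ := exists_ofFn_of_add_eq (hQ.add_eq.trans he)
        (by simpa using hQ.length_eq : l.length = s)
      exact ⟨g, Finset.mem_filter.2 ⟨Finset.mem_univ _, R, c, hQ⟩, R, c, hf, hQ⟩
    · rintro g - f₁ ⟨-, R₁, c₁, h₁, h₁'⟩ f₂ ⟨-, R₂, c₂, h₂, h₂'⟩
      obtain ⟨-, rfl, rfl⟩ := h₁'.right_unique h₂'
      exact DFunLike.coe_injective (List.ofFn_injective (h₁.left_unique h₂).2)
  · refine Finset.card_le_card_of_forall_subsingleton' r ?_ ?_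
    · intro g hg
      obtain ⟨R, c, hg⟩ := (Finset.mem_filter.1 hg).2
      have he := hg.add_eq.symm.trans (val_sdiff_add_ofFn g)
      have hc : c.length = s := by simpa using hg.count_eq
      obtain ⟨Q, l, hQ⟩ := (BumpRun.exists_iff (hc.trans hs.symm) (hlen hc he)
        (he ▸ Finset.univ.nodup)).2 ⟨_, _, by rwa [hc]⟩
      obtain ⟨f, rfl, rfl⟩ := exists_ofFn_of_add_eq (hQ.add_eq.trans he)
        (hQ.length_eq.trans hk)
      exact ⟨f, Finset.mem_filter.2 ⟨Finset.mem_univ _, R, c, hQ⟩, R, c, hQ, hg⟩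
    · rintro f - g₁ ⟨-, R₁, c₁, h₁, h₁'⟩ g₂ ⟨-, R₂, c₂, h₂, h₂'⟩
      obtain ⟨-, rfl, rfl⟩ := h₁.right_unique h₂
      exact DFunLike.coe_injective (List.ofFn_injective (h₁'.left_unique h₂').2)

theorem hasBumps_replicate_iff {α : Type*} [LinearOrder α] [Fintype α] {s : ℕ} (g : Fin s ↪ α) :
    HasBumps (List.replicate s true) g ↔
      ¬ HasLongIncr (Finset.univ \ (List.ofFn g).toFinset) (List.ofFn g) := by
  obtain ⟨β, ⟨R, c, h⟩, hu⟩ := HasBumps.existsUnique g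
  rw [← h.eq_replicate_iff (h.add_eq ▸ val_sdiff_add_ofFn g ▸ Finset.univ.nodup),
    List.length_ofFn]
  constructor
  · exact fun h' => (hu _ h').symm
  · rintro rfl
    exact ⟨R, c, h⟩

/-! ### Permutations with increasing head and their tails -/

/-- The last `s` entries of a permutation. -/
def tailEmb {m s : ℕ} (w : Equiv.Perm (Fin (m + s))) : Fin s ↪ Fin (m + s) :=
  (Fin.natAddEmb m).trans w.toEmbedding

/-- The tail fixes the set of head values, and an increasing head is determined by its set of
values. -/
theorem tailEmb_injOn {m s : ℕ} : Set.InjOn (tailEmb (m := m) (s := s))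
    {w | ∀ i j : Fin (m + s), i < j → (j : ℕ) < m → w i < w j} := by
  intro w hw v hv h
  have htail : ∀ i : Fin s, w (Fin.natAdd m i) = v (Fin.natAdd m i) := fun i =>
    DFunLike.congr_fun h i
  have hmono : ∀ u ∈ {w : Equiv.Perm (Fin (m + s)) |
      ∀ i j : Fin (m + s), i < j → (j : ℕ) < m → w i < w j},
      StrictMono fun i : Fin m => u (Fin.castAdd s i) := fun u hu i j hij =>
    hu _ _ (Fin.lt_def.2 hij) (by simp)
  have hrange : ∀ u : Equiv.Perm (Fin (m + s)), Set.range (fun i : Fin m => u (Fin.castAdd s i)) =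
      (Set.range fun i : Fin s => u (Fin.natAdd m i))ᶜ := by
    intro u
    ext a
    obtain ⟨i, rfl⟩ := u.surjective a
    refine Fin.addCases (fun i => ?_) (fun i => ?_) i
    · simp [Fin.ext_iff]
      intro j hj
      lia
    · simp [Fin.ext_iff]
      intro j hj
      lia
  have hhead := (hmono w hw).range_inj (hmono v hv) |>.1 (by simp only [hrange, htail])
  ext i : 1
  exact Fin.addCases (fun i => congrFun hhead i) htail i

theorem exists_tailEmb_eq {m s : ℕ} (g : Fin s ↪ Fin (m + s)) :
    ∃ w : Equiv.Perm (Fin (m + s)),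
      (∀ i j : Fin (m + s), i < j → (j : ℕ) < m → w i < w j) ∧ tailEmb w = g := by
  obtain ⟨R, hR⟩ : ∃ R : Finset (Fin (m + s)), R = (Finset.univ.map g)ᶜ := ⟨_, rfl⟩
  have hcard : R.card = m := by simp [hR, Finset.card_compl]
  have hinj : Function.Injective (Fin.append (R.orderEmbOfFin hcard) g) := by
    rw [Fin.append_injective_iff]
    refine ⟨(R.orderEmbOfFin hcard).injective, g.injective, fun i j h => ?_⟩
    have := R.orderEmbOfFin_mem hcard i
    rw [h, hR] at this
    simp at this
  refine ⟨Equiv.ofBijective _ (Finite.injective_iff_bijective.1 hinj), fun i j hij hj => ?_, ?_⟩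
  · obtain ⟨i', rfl⟩ : ∃ i' : Fin m, i = Fin.castAdd s i' := ⟨⟨i, (Fin.lt_def.1 hij).trans hj⟩, rfl⟩
    obtain ⟨j', rfl⟩ : ∃ j' : Fin m, j = Fin.castAdd s j' := ⟨⟨j, hj⟩, rfl⟩
    have hij' : i' < j' := Fin.lt_def.2 (Fin.lt_def.1 hij)
    simpa using hij'
  · ext i
    simp [tailEmb]

open Classical in
theorem card_piSet (m s : ℕ) : (PiSet (m + s) s).card =
    (Finset.univ.filter fun g : Fin s ↪ Fin (m + s) =>
      HasBumps (List.replicate s true) g).card := by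
  have hmem : ∀ w, w ∈ PiSet (m + s) s ↔
      (∀ i j : Fin (m + s), i < j → (j : ℕ) < m → w i < w j) ∧
        HasBumps (List.replicate s true) (tailEmb w) := by
    intro w
    simp only [PiSet, Finset.mem_filter, Finset.mem_univ, true_and, Nat.add_lt_add_iff_right,
      Nat.add_right_cancel_iff]
    refine and_congr_right fun hw => ?_
    rw [longestIncr_eq_iff w hw, hasBumps_replicate_iff]
    rfl
  refine Finset.card_nbij tailEmb ?_ ?_ ?_
  · intro w hw
    simpa using ((hmem w).1 hw).2
  · exact tailEmb_injOn.mono fun w hw => ((hmem w).1 hw).1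
  · intro g hg
    obtain ⟨w, hw, rfl⟩ := exists_tailEmb_eq g
    exact ⟨w, (hmem w).2 ⟨hw, by simpa using hg⟩, rfl⟩

/-! ### Summation over all patterns -/

theorem count_ofFn_true {k : ℕ} (B : Finset (Fin k)) :
    (List.ofFn fun i => decide (i ∈ B)).count true = B.card := by
  rw [List.ofFn_eq_map, List.count, List.countP_map, List.countP_eq_length_filter,
    ← List.toFinset_card_of_nodup ((List.nodup_finRange k).filter _)]
  congr 1
  ext i
  simp

theorem proposition1 (n k : ℕ) (hnk : 2 * k ≤ n) :
    ∑ s ∈ Finset.range (k + 1), k.choose s * (PiSet n s).card = n.choose k * k.factorial := by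
  classical
  have hfib : ∀ B : Finset (Fin k), (Finset.univ.filter fun f : Fin k ↪ Fin n =>
      HasBumps (List.ofFn fun i => decide (i ∈ B)) f).card = (PiSet n B.card).card := by
    intro B
    have hB : B.card ≤ k := by simpa using B.card_le_univ
    -- The condition `k + B.card ≤ n` holds since `B.card ≤ k` and `2 * k ≤ n`.
    rw [card_hasBumps (by simp) (count_ofFn_true B) (by simp; lia)]
    obtain ⟨m, hm⟩ : ∃ m, n = m + B.card := ⟨n - B.card, by lia⟩
    generalize B.card = s at *
    subst hm
    rw [card_piSet]
  -- A pattern is encoded by its set of bumping positions, which turns the binomial weights into a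
  -- sum over subsets of `Fin k`.
  have hsum := Finset.sum_powerset_apply_card (fun s => (PiSet n s).card)
    (x := (Finset.univ : Finset (Fin k)))
  simp only [Finset.card_univ, Fintype.card_fin, smul_eq_mul] at hsum
  rw [← hsum, mul_comm, ← Nat.descFactorial_eq_factorial_mul_choose]
  simp only [← hfib]
  rw [← Finset.card_biUnion]
  · trans (Finset.univ : Finset (Fin k ↪ Fin n)).card
    · congr 1
      ext f
      simp only [Finset.mem_biUnion, Finset.mem_filter, Finset.mem_univ, true_and, iff_true]
      obtain ⟨β, ⟨R, c, h⟩, -⟩ := HasBumps.existsUnique f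
      have hlen : β.length = k := by simpa using h.length_eq.symm
      subst hlen
      refine ⟨Finset.univ.filter fun i => β.get i = true, by simp, R, c, ?_⟩
      convert h
      simp
    · simp [Finset.card_univ, Fintype.card_embedding_eq]
  · intro B _ B' _ hne
    rw [Function.onFun, Finset.disjoint_left]
    intro f hf hf'
    simp only [Finset.mem_filter, Finset.mem_univ, true_and] at hf hf'
    have := List.ofFn_injective ((HasBumps.existsUnique f).unique hf hf')
    refine hne (Finset.ext fun i => ?_)
    simpa using congrFun this i
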